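/- **Proposition (Conditional dSMC).** Let $\mathcal X$ be a measurable space and $T\in\mathbb N$. For $1\le t\le T$ let $P_t(dx_t\mid x_{t-1})$ be Markov kernels on $\mathcal X$ and $h_t:\mathcal X\to[0,\infty)$ measurable potentials; for $0\le t\le T$ let $\nu_t$ be probability measures on $\mathcal X$ such that $P_t(\cdot\mid x)\ll\nu_t$ for all $t\ge1$ and all $x\in\mathcal X$. For $0\le a\le b\le T$ the partial smoothing distribution is $$\mathbb Q_{a:b}(dx_{a:b})=\frac1{L_{a:b}}\,\nu_a(dx_a)\prod_{t=a+1}^bP_t(dx_t\mid x_{t-1})\prod_{t=a+1}^bh_t(x_t),$$ where $L_{a:b}$ is the normalizing constant. For $1\le t\le T$ let $\omega_t:\mathcal X\times\mathcal X\to[0,\infty)$ be a jointly measurable function such that, for every $x\in\mathcal X$, $\omega_t(x,\cdot)$ is a version of the Radon–Nikodym derivative $P_t(dy\mid x)h_t(y)/\nu_t(dy)$. For $0\le t\le T$ let $q_t$ be a proposal probability measure with $\nu_t\ll q_t$, and let $w_t:\mathcal X\to[0,\infty)$ be a measurable version of $d\nu_t/dq_t$ (for instance $q_t=\nu_t$,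 $w_t=1$). Let $N\ge1$. Fix an ordered binary tree on $\{a,\dots,b\}$: its leaves are $\{a\},\dots,\{b\}$, and every node that is not a leaf is an interval $\{a',\dots,b'\}$ with children $\{a',\dots,c'-1\}$ and $\{c',\dots,b'\}$ for some $a'<c'\le b'$. The dSMC algorithm with $N$ particles on this tree is defined recursively. Throughout, normalized weights are taken to be uniform if all the weights to be normalized vanish. * At a leaf $\{k\}$, draw $x_k^1,\dots,x_k^N$ independently from $q_k$. Put $\sigma^n_{k:k}(k)=n$ and $L^N_{k:k}=\frac1N\sum_nw_k(x_k^n)$, and give the $n$-th particle the weight $w^n=w_k(x_k^n)/\sum_mw_k(x_k^m)$. * At a node $\{a',\dots,b'\}$ split at $c'$, run the algorithm independently on the two children. Let $w^m_{\mathrm{left}}$, $w^n_{\mathrm{right}}$ be the normalized weights they return, and set $$U^{m,n}=w^m_{\mathrm{left}}\,w^n_{\mathrm{right}}\;\omega_{c'}\Big(x_{c'-1}^{\sigma^m_{a':c'-1}(c'-1)},\,x_{c'}^{\sigma^n_{c':b'}(c')}\Big),\qquad W_{c'}^{m,n}=\frac{U^{m,n}}{\sum_{i,j}U^{i,j}},\qquad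 L^N_{a':b'}=L^N_{a':c'-1}\,L^N_{c':b'}\sum_{i,j=1}^NU^{i,j}.$$ Draw $N$ index pairs $(l^n_{c'},r^n_{c'})$ independently from the matrix $W_{c'}$. Put $\sigma^n_{a':b'}(k)=\sigma^{l^n_{c'}}_{a':c'-1}(k)$ for $k<c'$ and $\sigma^n_{a':b'}(k)=\sigma^{r^n_{c'}}_{c':b'}(k)$ for $k\ge c'$. The returned weights are $1/N$. Let $0\le a<c\le b\le T$, suppose that the root $\{a,\dots,b\}$ of the tree is split at $c$, and suppose that $0<L_{a:b}<\infty$. Let $\psi_{a:b}$ be the law of all the variables so generated except the index pairs $(l_c^n,r_c^n)_{n}$ of the root (that is, the product of the laws of all the variables generated on the two children of the root), and let $\pi_{a:b}=\frac{L^N_{a:b}}{L_{a:b}}\,\psi_{a:b}$. Then $\pi_{a:b}$ and $\mathbb Q_{a:b}$ are probability measures. Moreover, let the variables have law $\pi_{a:b}$, let $(I,J)$ be drawn, given these variables, from the root weight matrix $W_c$, and define the star trajectory $X^*_{a:b}$ by $$X^*_k=x_k^{\sigma^I_{a:c-1}(k)}\quad(a\le k<c),\qquad X^*_k=x_k^{\sigma^J_{c:b}(k)}\quad(c\le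 k\le b).$$ Then the marginal law of $X^*_{a:b}$ is $\mathbb Q_{a:b}$. -/

import Mathlib

open MeasureTheory ProbabilityTheory
open scoped ENNReal NNReal

noncomputable section

namespace DSMC

/-- A Feynman-Kac model on the state space `X` with times `0, …, T`: transition kernels
`P t (x_{t-1}, dx_t)` (used for `1 ≤ t ≤ T`), potentials `h t`, and auxiliary probability measures
`ν t` that dominate the transition kernels. -/
structure Model (X : Type*) [MeasurableSpace X] (T : ℕ) where
  P : ℕ → Kernel X X
  markov_P : ∀ t, IsMarkovKernel (P t)
  h : ℕ → X → ℝ≥0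
  measurable_h : ∀ t, Measurable (h t)
  ν : ℕ → Measure X
  prob_ν : ∀ t, IsProbabilityMeasure (ν t)
  ac : ∀ t, 0 < t → t ≤ T → ∀ x, P t x ≪ ν t

/-- Trajectories `x_{a:b}`. -/
abbrev Path (X : Type*) (a b : ℕ) : Type _ := Set.Icc a b → X

section PartialSmoothing

variable {X : Type*} [MeasurableSpace X] {T : ℕ} (M : Model X T)

/-- Appends the state `x_{b+1}` to the trajectory `x_{a:b}`. -/
def appendState {a b : ℕ} (p : Path X a b × X) : Path X a (b + 1) :=
  fun k => if hk : (k : ℕ) ≤ b then p.1 ⟨k, k.2.1, hk⟩ else p.2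

/-- The law `ν_a(dx_a) ∏_{t=a+1}^b P_t(dx_t | x_{t-1})` on trajectories `x_{a:b}`, for `a ≤ b`
(for `b < a` the value is irrelevant). -/
def markovLaw (a : ℕ) : (b : ℕ) → Measure (Path X a b)
  | 0 => (M.ν a).map fun x _ => x
  | b + 1 =>
    if hab : a ≤ b then
      (markovLaw a b ⊗ₘ (M.P (b + 1)).comap (fun x : Path X a b => x ⟨b, hab, le_rfl⟩)
        (measurable_pi_apply _)).map appendState
    else (M.ν a).map fun x _ => x

/-- The unnormalized partial smoothing measure
`ν_a(dx_a) ∏_{t=a+1}^b P_t(dx_t | x_{t-1}) ∏_{t=a+1}^b h_t(x_t)`. -/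
def unnormSmoothing (a b : ℕ) : Measure (Path X a b) :=
  (markovLaw M a b).withDensity fun x =>
    ∏ k : Set.Icc a b, if a < (k : ℕ) then (M.h k (x k) : ℝ≥0∞) else 1

/-- The normalizing constant `L_{a:b}`. -/
def normConst (a b : ℕ) : ℝ≥0∞ := unnormSmoothing M a b Set.univ

/-- The partial smoothing distribution `Q_{a:b}`. -/
def smoothing (a b : ℕ) : Measure (Path X a b) :=
  (normConst M a b)⁻¹ • unnormSmoothing M a b

end PartialSmoothing

/-- What the sampler uses on top of the model: proposals `q t` with `ν t ≪ q t`, a measurable version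
`w t` of the importance weight `dν_t / dq_t`, and a jointly measurable version `ω t` of the
Radon-Nikodym derivative `P_t(dx_t | x_{t-1}) h_t(x_t) / ν_t(dx_t)`, for `1 ≤ t ≤ T`.
The case `q t = ν t`, `w t = 1` is that of equally weighted initial particles. -/
structure Sampler {X : Type*} [MeasurableSpace X] {T : ℕ} (M : Model X T) where
  q : ℕ → Measure X
  prob_q : ∀ t, IsProbabilityMeasure (q t)
  ac : ∀ t, t ≤ T → M.ν t ≪ q t
  w : ℕ → X → ℝ≥0
  measurable_w : ∀ t, Measurable (w t)
  w_ae : ∀ t, t ≤ T → (fun x => (w t x : ℝ≥0∞)) =ᵐ[q t] (M.ν t).rnDeriv (q t)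
  ω : ℕ → X → X → ℝ≥0
  measurable_ω : ∀ t, Measurable (Function.uncurry (ω t))
  ω_ae : ∀ t, 0 < t → t ≤ T → ∀ x, (fun y => (ω t x y : ℝ≥0∞)) =ᵐ[M.ν t]
    ((M.P t x).withDensity fun y => (M.h t y : ℝ≥0∞)).rnDeriv (M.ν t)

/-- Ordered binary trees on `{a, …, b}`: a node splits `{a, …, b}` into `{a, …, c}` and
`{c + 1, …, b}`. -/
inductive SplitTree : ℕ → ℕ → Type
  | leaf (a : ℕ) : SplitTree a a
  | node {a c b : ℕ} (l : SplitTree a c) (r : SplitTree (c + 1) b) : SplitTree a b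

theorem SplitTree.le {a b : ℕ} (t : SplitTree a b) : a ≤ b := by
  induction t with
  | leaf a => exact le_rfl
  | node l r hl hr => omega

/-- Normalizes weights to sum to one; if they all vanish the uniform weights are used. -/
def normalizeWeights {ι : Type*} [Fintype ι] (u : ι → ℝ≥0) (i : ι) : ℝ≥0 :=
  if ∑ j, u j = 0 then (Fintype.card ι : ℝ≥0)⁻¹ else u i / ∑ j, u j

section Algorithm

variable (X : Type*) (N : ℕ)

/-- The values of all random variables generated by dSMC on the tree: at each leaf the `N` particles
sampled there, at each node the `N` pairs of resampling indices `(l^n, r^n)` generated there. -/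
def Vars : {a b : ℕ} → SplitTree a b → Type _
  | _, _, .leaf _ => Fin N → X
  | _, _, .node l r => (Vars l × Vars r) × (Fin N → Fin N × Fin N)

instance Vars.instMeasurableSpace [MeasurableSpace X] :
    {a b : ℕ} → (t : SplitTree a b) → MeasurableSpace (Vars X N t)
  | _, _, .leaf _ => inferInstanceAs (MeasurableSpace (Fin N → X))
  | _, _, .node l r =>
    letI := Vars.instMeasurableSpace l
    letI := Vars.instMeasurableSpace r
    inferInstanceAs (MeasurableSpace ((Vars X N l × Vars X N r) × (Fin N → Fin N × Fin N)))

variable {X N}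

/-- The particle `x_k^n` sampled at the leaf `k`. -/
def particle : {a b : ℕ} → (t : SplitTree a b) → Vars X N t → Set.Icc a b → Fin N → X
  | _, _, .leaf _, v, _, n => v n
  | _, _, .node (c := c) l r, v, k, n =>
    if hk : (k : ℕ) ≤ c then particle l v.1.1 ⟨k, k.2.1, hk⟩ n
    else particle r v.1.2 ⟨k, not_le.1 hk, k.2.2⟩ n

/-- The resampled index `σ^n_{a:b}(k)`. -/
def sigma : {a b : ℕ} → (t : SplitTree a b) → Vars X N t → Fin N → Set.Icc a b → Fin N
  | _, _, .leaf _, _, n, _ => n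
  | _, _, .node (c := c) l r, v, n, k =>
    if hk : (k : ℕ) ≤ c then sigma l v.1.1 (v.2 n).1 ⟨k, k.2.1, hk⟩
    else sigma r v.1.2 (v.2 n).2 ⟨k, not_le.1 hk, k.2.2⟩

/-- The state at time `k` of the `n`-th trajectory returned by dSMC, `x_k^{σ^n_{a:b}(k)}`. -/
def traj {a b : ℕ} (t : SplitTree a b) (v : Vars X N t) (n : Fin N) : Path X a b :=
  fun k => particle t v k (sigma t v n k)

variable [MeasurableSpace X] {T : ℕ} {M : Model X T} (S : Sampler M)

/-- The normalized weights of the trajectories returned by dSMC: importance weights at a leaf, `1/N`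
after a resampling step. -/
def weight : {a b : ℕ} → (t : SplitTree a b) → Vars X N t → Fin N → ℝ≥0
  | _, _, .leaf k, v, n => normalizeWeights (fun m => S.w k (v m)) n
  | _, _, .node _ _, _, _ => (N : ℝ≥0)⁻¹

/-- The unnormalized entries of the weight matrix for stitching at `c + 1`:
`w^m_c w^n_{c+1} ω_{c+1}(x_c^{σ^m_{a:c}(c)}, x_{c+1}^{σ^n_{c+1:b}(c+1)})`. -/
def stitchWeight {a c b : ℕ} (l : SplitTree a c) (r : SplitTree (c + 1) b) (v : Vars X N l × Vars X N r)
    (mn : Fin N × Fin N) : ℝ≥0 :=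
  weight S l v.1 mn.1 * weight S r v.2 mn.2 *
    S.ω (c + 1) (traj l v.1 mn.1 ⟨c, l.le, le_rfl⟩) (traj r v.2 mn.2 ⟨c + 1, le_rfl, r.le⟩)

/-- The weight matrix `W_{c+1}^{m,n}`. -/
def weightMatrix {a c b : ℕ} (l : SplitTree a c) (r : SplitTree (c + 1) b) (v : Vars X N l × Vars X N r) :
    Fin N × Fin N → ℝ≥0 :=
  normalizeWeights (stitchWeight S l r v)

/-- The law `ψ_{a:b}` of all random variables generated by dSMC: independent particles
`x_k^n ~ q_k` at the leaves; at a node the index pairs have, given everything generated in the two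
subtrees, the (multinomial) probability mass function `∏_n W^{l^n, r^n}`. -/
def psi : {a b : ℕ} → (t : SplitTree a b) → Measure (Vars X N t)
  | _, _, .leaf k => Measure.pi fun _ : Fin N => S.q k
  | _, _, .node l r =>
    (((psi l).prod (psi r)).prod (Measure.count : Measure (Fin N → Fin N × Fin N))).withDensity
      fun v => ∏ n, (weightMatrix S l r v.1 (v.2 n) : ℝ≥0∞)

/-- The estimate `L^N_{a:b}` of the normalizing constant. -/
def normEst : {a b : ℕ} → (t : SplitTree a b) → Vars X N t → ℝ≥0
  | _, _, .leaf k, v => (N : ℝ≥0)⁻¹ * ∑ n, S.w k (v n)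
  | _, _, .node l r, v =>
    normEst l v.1.1 * normEst r v.1.2 * ∑ mn, stitchWeight S l r v.1 mn

/-- The estimate `L^N_{a:b}` for a tree with root `node l r`; it does not depend on the indices
generated at the root. -/
def rootNormEst {a c b : ℕ} (l : SplitTree a c) (r : SplitTree (c + 1) b) (v : Vars X N l × Vars X N r) :
    ℝ≥0 :=
  normEst S l v.1 * normEst S r v.2 * ∑ mn, stitchWeight S l r v mn

/-- The law `π_{a:b} = (L^N_{a:b} / L_{a:b}) ψ_{a:b}` of all variables but the index pairs of the
root, for the tree with root `node l r`. The marginal of `ψ_{a:b}` on these variables is the product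
of the laws for the two subtrees. -/
def extendedTarget (N : ℕ) {a c b : ℕ} (l : SplitTree a c) (r : SplitTree (c + 1) b) :
    Measure (Vars X N l × Vars X N r) :=
  ((psi S l).prod (psi S r)).withDensity fun v => (rootNormEst S l r v : ℝ≥0∞) / normConst M a b

/-- The joint law of the variables distributed according to `π_{a:b}` and of the pair `(I, J)`, drawn
from the weight matrix at the root. -/
def starLaw (N : ℕ) {a c b : ℕ} (l : SplitTree a c) (r : SplitTree (c + 1) b) :
    Measure ((Vars X N l × Vars X N r) × (Fin N × Fin N)) :=
  ((extendedTarget S N l r).prod (Measure.count : Measure (Fin N × Fin N))).withDensity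
    fun p => (weightMatrix S l r p.1 p.2 : ℝ≥0∞)

end Algorithm

section Star

variable {X : Type*} {N : ℕ}

/-- The star trajectory `X*_{a:b} = [X^{σ^I_{a:c}}_{a:c}, X^{σ^J_{c+1:b}}_{c+1:b}]`. -/
def starTraj {a c b : ℕ} (l : SplitTree a c) (r : SplitTree (c + 1) b)
    (p : (Vars X N l × Vars X N r) × (Fin N × Fin N)) : Path X a b :=
  fun k =>
    if hk : (k : ℕ) ≤ c then traj l p.1.1 p.2.1 ⟨k, k.2.1, hk⟩
    else traj r p.1.2 p.2.2 ⟨k, not_le.1 hk, k.2.2⟩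

end Star

end DSMC

end

open DSMC

/-! The core is unbiasedness (`isUnbiased`): under `psi`, the mean of `normEst` times the weighted
sum of `f` over the returned trajectories is the integral of `f` against the unnormalized smoothing
measure. This goes by induction on the tree.

At a leaf it is importance sampling, since the normalizer of the weights cancels against the
estimate. At a node, `rootNormEst * weightMatrix` equals the product of the child estimates and the
raw stitching weight. The children are independent, so their unbiasedness replaces each by its exact
smoothing measure (`lintegral_rootNormEst_mul_sum`). The density `ω` then glues the two measures
together (`lintegral_stitch`). Resampling preserves conditional means (`sum_prod_mul_average`).

At the root the node computation is used before resampling: reweighting by the estimate and drawing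
one pair from the weight matrix gives the smoothing measure, and `f = 1` gives the total mass. -/

noncomputable section

namespace DSMC

/-! ### Normalized weights and multinomial resampling -/

section NormalizeWeights

variable {ι : Type*} [Fintype ι]

theorem sum_normalizeWeights [Nonempty ι] (u : ι → ℝ≥0) : ∑ i, normalizeWeights u i = 1 := by
  unfold normalizeWeights
  split_ifs with h
  · simp
  · rw [← Finset.sum_div, div_self h]

/-- If the sum is zero, so is each nonnegative term; hence the uniform convention never affects this
cancellation. -/
theorem sum_mul_normalizeWeights (u : ι → ℝ≥0) (i : ι) :
    (∑ j, u j) * normalizeWeights u i = u i := by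
  unfold normalizeWeights
  split_ifs with h
  · rw [h, zero_mul, (Finset.sum_eq_zero_iff.1 h) i (Finset.mem_univ i)]
  · rw [mul_div_cancel₀ _ h]

theorem measurable_normalizeWeights {Ω : Type*} [MeasurableSpace Ω] {u : Ω → ι → ℝ≥0}
    (hu : ∀ i, Measurable fun v => u v i) (i : ι) :
    Measurable fun v => normalizeWeights (u v) i := by
  have hs : Measurable fun v => ∑ j, u v j := Finset.measurable_sum _ fun j _ => hu j
  exact Measurable.ite (hs (measurableSet_singleton 0)) measurable_const ((hu i).div hs)

/-- A single coordinate of a vector of independent draws from `W` has law `W`. -/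
theorem sum_prod_mul_apply {κ : Type*} [Fintype κ] [DecidableEq κ] (W g : ι → ℝ≥0∞)
    (hW : ∑ i, W i = 1) (k : κ) :
    ∑ x : κ → ι, (∏ n, W (x n)) * g (x k) = ∑ i, W i * g i := by
  classical
  -- Inserting `g` in the `k`-th factor only lets the sum over draws factor; all other factors are
  -- the total mass 1.
  have h := Finset.prod_univ_sum (fun _ : κ => (Finset.univ : Finset ι))
    (fun n i => W i * if n = k then g i else 1)
  rw [Fintype.piFinset_univ] at h
  simp only [Finset.prod_mul_distrib, Finset.prod_ite_eq', Finset.mem_univ, if_true] at h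
  rw [← h, Finset.prod_eq_single k]
  · simp
  · intro n _ hn
    simp [hn, hW]
  · simp

theorem sum_prod_mul_average {N : ℕ} (hN : 0 < N) (W g : ι → ℝ≥0∞) (hW : ∑ i, W i = 1) :
    ∑ x : Fin N → ι, (∏ n, W (x n)) * ∑ k, (N : ℝ≥0∞)⁻¹ * g (x k) = ∑ i, W i * g i := by
  simp_rw [Finset.mul_sum, mul_left_comm _ (N : ℝ≥0∞)⁻¹]
  rw [Finset.sum_comm]
  simp_rw [← Finset.mul_sum, sum_prod_mul_apply W g hW]
  rw [Finset.sum_const, Finset.card_univ, Fintype.card_fin, nsmul_eq_mul, ← mul_assoc,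
    ENNReal.inv_mul_cancel (by simpa using hN.ne') (by simp), one_mul]

end NormalizeWeights

/-! ### Concatenating and extending trajectories -/

section Paths

variable {X : Type*}

/-- Concatenation of the trajectories `x_{a:c}` and `y_{c+1:b}`. -/
def concat {a c b : ℕ} (x : Path X a c) (y : Path X (c + 1) b) : Path X a b :=
  fun k => if hk : (k : ℕ) ≤ c then x ⟨k, k.2.1, hk⟩ else y ⟨k, not_le.1 hk, k.2.2⟩

theorem concat_appendState {a c b : ℕ} (hcb : c + 1 ≤ b) (x : Path X a c) (y : Path X (c + 1) b)
    (z : X) : concat x (appendState (y, z)) = appendState (concat x y, z) := by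
  funext k
  simp only [concat, appendState]
  split_ifs <;> first | rfl | omega

variable [MeasurableSpace X]

theorem measurable_concat {a c b : ℕ} :
    Measurable fun p : Path X a c × Path X (c + 1) b => concat p.1 p.2 := by
  refine measurable_pi_lambda _ fun k => ?_
  unfold concat
  split_ifs with hk
  · fun_prop
  · fun_prop

theorem measurable_appendState {a b : ℕ} :
    Measurable (appendState : Path X a b × X → Path X a (b + 1)) := by
  refine measurable_pi_lambda _ fun k => ?_
  unfold appendState
  split_ifs with hk
  · fun_prop
  · fun_prop

end Paths

/-! ### Recursion for the unnormalized smoothing measure -/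

section PartialSmoothing

variable {X : Type*} [MeasurableSpace X] {T : ℕ} (M : Model X T)

instance sFinite_markovLaw (a b : ℕ) : SFinite (markovLaw M a b) := by
  have := M.prob_ν a
  induction b with
  | zero => unfold markovLaw; infer_instance
  | succ b ih => unfold markovLaw; split_ifs <;> infer_instance

theorem measurable_potential (a b : ℕ) : Measurable fun x : Path X a b =>
    ∏ k : Set.Icc a b, if a < (k : ℕ) then (M.h k (x k) : ℝ≥0∞) else 1 := by
  refine Finset.measurable_prod _ fun k _ => ?_
  split_ifs
  · exact ((M.measurable_h k).comp (measurable_pi_apply k)).coe_nnreal_ennreal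
  · exact measurable_const

/-- The constants of subintervals may be infinite, but s-finiteness is enough for measurability of
partial integrals. -/
instance sFinite_unnormSmoothing (a b : ℕ) : SFinite (unnormSmoothing M a b) := by
  unfold unnormSmoothing; infer_instance

theorem markovLaw_self (a : ℕ) : markovLaw M a a = (M.ν a).map fun x _ => x := by
  cases a with
  | zero => rfl
  | succ a => rw [markovLaw, dif_neg (by omega)]

theorem lintegral_unnormSmoothing_self (a : ℕ) {f : Path X a a → ℝ≥0∞} (hf : Measurable f) :
    ∫⁻ x, f x ∂unnormSmoothing M a a = ∫⁻ x, f (fun _ => x) ∂M.ν a := by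
  have h1 : (fun x : Path X a a =>
      ∏ k : Set.Icc a a, if a < (k : ℕ) then (M.h k (x k) : ℝ≥0∞) else 1) = 1 := by
    funext x
    refine Finset.prod_eq_one fun k _ => ?_
    rw [if_neg (not_lt.2 k.2.2)]
  rw [unnormSmoothing, h1, withDensity_one, markovLaw_self, lintegral_map hf (by fun_prop)]

theorem potential_appendState {a b : ℕ} (hab : a ≤ b) (x : Path X a b) (y : X) :
    (∏ k : Set.Icc a (b + 1),
      if a < (k : ℕ) then (M.h k (appendState (x, y) k) : ℝ≥0∞) else 1) =
      (∏ k : Set.Icc a b, if a < (k : ℕ) then (M.h k (x k) : ℝ≥0∞) else 1) *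
        M.h (b + 1) y := by
  let last : Set.Icc a (b + 1) := ⟨b + 1, by omega, le_rfl⟩
  rw [← Finset.prod_erase_mul Finset.univ _ (Finset.mem_univ last)]
  congr 1
  · symm
    refine Finset.prod_bij (fun k _ => ⟨k, k.2.1, by have := k.2.2; omega⟩) ?_ ?_ ?_ ?_
    · intro k _
      have := k.2.2
      refine Finset.mem_erase.2 ⟨fun h => ?_, Finset.mem_univ _⟩
      have : (k : ℕ) = b + 1 := congrArg Subtype.val h
      omega
    · intro k _ k' _ h
      exact Subtype.ext (Subtype.mk.inj h)
    · intro k hk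
      have h1 := k.2.2
      have h2 : (k : ℕ) ≠ b + 1 := fun h => (Finset.mem_erase.1 hk).1 (Subtype.ext h)
      exact ⟨⟨k, k.2.1, by omega⟩, Finset.mem_univ _, rfl⟩
    · intro k _
      have h : (k : ℕ) ≤ b := k.2.2
      simp [appendState, h]
  · simp [last, appendState, Nat.lt_succ_of_le hab]

theorem lintegral_unnormSmoothing_succ {a b : ℕ} (hab : a ≤ b) {f : Path X a (b + 1) → ℝ≥0∞}
    (hf : Measurable f) :
    ∫⁻ x, f x ∂unnormSmoothing M a (b + 1) =
      ∫⁻ x, ∫⁻ y, M.h (b + 1) y * f (appendState (x, y)) ∂M.P (b + 1) (x ⟨b, hab, le_rfl⟩)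
        ∂unnormSmoothing M a b := by
  have := M.markov_P (b + 1)
  have hh := (M.measurable_h (b + 1)).coe_nnreal_ennreal
  have happ := measurable_appendState (X := X) (a := a) (b := b)
  have hg : Measurable fun p : Path X a b × X =>
      (M.h (b + 1) p.2 : ℝ≥0∞) * f (appendState p) :=
    (hh.comp measurable_snd).mul (hf.comp happ)
  have hpot := measurable_potential M a (b + 1)
  rw [unnormSmoothing, lintegral_withDensity_eq_lintegral_mul _ hpot hf, markovLaw, dif_pos hab,
    lintegral_map (hpot.mul hf) happ,
    Measure.lintegral_compProd (f := fun p => (_ * f) (appendState p))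
      ((hpot.mul hf).comp happ), unnormSmoothing,
    lintegral_withDensity_eq_lintegral_mul _ (measurable_potential M a b)]
  · refine lintegral_congr fun x => ?_
    rw [Pi.mul_apply, ← lintegral_const_mul]
    · refine lintegral_congr fun y => ?_
      rw [Pi.mul_apply, potential_appendState M hab, mul_assoc]
    · exact hg.comp measurable_prodMk_left
  · exact hg.lintegral_kernel_prod_right'
      (κ := (M.P (b + 1)).comap (fun x : Path X a b => x ⟨b, hab, le_rfl⟩)
        (measurable_pi_apply _))

/-! ### Changes of measure by `ω` and `w`, and stitching -/

variable {M} (S : Sampler M)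

theorem measurable_coe_ω {Ω : Type*} [MeasurableSpace Ω] (t : ℕ) {f g : Ω → X}
    (hf : Measurable f) (hg : Measurable g) :
    Measurable fun v => (S.ω t (f v) (g v) : ℝ≥0∞) :=
  ((S.measurable_ω t).comp (hf.prodMk hg)).coe_nnreal_ennreal

theorem lintegral_ω_mul {t : ℕ} (ht : 0 < t) (htT : t ≤ T) (x : X) {f : X → ℝ≥0∞}
    (hf : Measurable f) :
    ∫⁻ y, S.ω t x y * f y ∂M.ν t = ∫⁻ y, M.h t y * f y ∂M.P t x := by
  have := M.markov_P t
  have := M.prob_ν t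
  have hh := (M.measurable_h t).coe_nnreal_ennreal
  have hω : Measurable fun y => (S.ω t x y : ℝ≥0∞) :=
    measurable_coe_ω S t measurable_const measurable_id
  -- The potential is finite-valued but possibly unbounded or non-integrable, so only σ-finiteness
  -- is available.
  have : SigmaFinite ((M.P t x).withDensity fun y => (M.h t y : ℝ≥0∞)) :=
    SigmaFinite.withDensity_of_ne_top' (by simp)
  have hac : (M.P t x).withDensity (fun y => (M.h t y : ℝ≥0∞)) ≪ M.ν t :=
    (withDensity_absolutelyContinuous _ _).trans (M.ac t ht htT x)
  have key : (M.ν t).withDensity (fun y => (S.ω t x y : ℝ≥0∞)) =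
      (M.P t x).withDensity fun y => (M.h t y : ℝ≥0∞) := by
    rw [withDensity_congr_ae (S.ω_ae t ht htT x), Measure.withDensity_rnDeriv_eq _ _ hac]
  have h := congrArg (fun μ => ∫⁻ y, f y ∂μ) key
  simpa only [lintegral_withDensity_eq_lintegral_mul _ hω hf,
    lintegral_withDensity_eq_lintegral_mul _ hh hf, Pi.mul_apply] using h

theorem lintegral_w_mul {t : ℕ} (htT : t ≤ T) {f : X → ℝ≥0∞} (hf : Measurable f) :
    ∫⁻ x, S.w t x * f x ∂S.q t = ∫⁻ x, f x ∂M.ν t := by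
  have := S.prob_q t
  have := M.prob_ν t
  have key : (S.q t).withDensity (fun x => (S.w t x : ℝ≥0∞)) = M.ν t := by
    rw [withDensity_congr_ae (S.w_ae t htT), Measure.withDensity_rnDeriv_eq _ _ (S.ac t htT)]
  rw [← key, lintegral_withDensity_eq_lintegral_mul _ (S.measurable_w t).coe_nnreal_ennreal hf]
  rfl

/-- Stitching two adjacent partial smoothing measures with the density `ω`. -/
theorem lintegral_stitch {a c b : ℕ} (hac : a ≤ c) (hcb : c + 1 ≤ b) (hb : b ≤ T)
    {f : Path X a b → ℝ≥0∞} (hf : Measurable f) :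
    ∫⁻ x, ∫⁻ y, S.ω (c + 1) (x ⟨c, hac, le_rfl⟩) (y ⟨c + 1, le_rfl, hcb⟩) * f (concat x y)
        ∂unnormSmoothing M (c + 1) b ∂unnormSmoothing M a c =
      ∫⁻ x, f x ∂unnormSmoothing M a b := by
  induction b, hcb using Nat.le_induction with
  -- The right segment is one state with law `ν (c + 1)` and no potential; `ω` turns this into the
  -- missing transition with its potential.
  | base =>
    rw [lintegral_unnormSmoothing_succ M hac hf]
    refine lintegral_congr fun x => ?_
    have hx : Measurable fun y : X => f (appendState (x, y)) :=
      hf.comp (measurable_appendState.comp measurable_prodMk_left)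
    rw [lintegral_unnormSmoothing_self, ← lintegral_ω_mul S (Nat.succ_pos c) hb _ hx]
    · rfl
    · exact (measurable_coe_ω S _ measurable_const (measurable_pi_apply _)).mul
        (hf.comp (measurable_concat.comp measurable_prodMk_left))
  | succ b hcb ih =>
    have hab : a ≤ b := by omega
    have := M.markov_P (b + 1)
    have hg : Measurable fun p : Path X a b × X =>
        (M.h (b + 1) p.2 : ℝ≥0∞) * f (appendState p) :=
      ((M.measurable_h (b + 1)).coe_nnreal_ennreal.comp measurable_snd).mul
        (hf.comp measurable_appendState)
    -- The last transition depends only on the end of the right segment, so it is the same on both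
    -- sides. Integrating it out leaves a new test function for `ih`.
    rw [lintegral_unnormSmoothing_succ M hab hf, ← ih (by omega)]
    · refine lintegral_congr fun x => ?_
      rw [lintegral_unnormSmoothing_succ M hcb]
      · refine lintegral_congr fun y => ?_
        have hlast : concat x y ⟨b, hab, le_rfl⟩ = y ⟨b, hcb, le_rfl⟩ :=
          dif_neg (show ¬ b ≤ c by omega)
        rw [hlast, ← lintegral_const_mul]
        · refine lintegral_congr fun z => ?_
          have hfirst : appendState (y, z) ⟨c + 1, le_rfl, by omega⟩ = y ⟨c + 1, le_rfl, hcb⟩ :=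
            dif_pos hcb
          rw [hfirst, concat_appendState hcb, mul_left_comm]
        · exact hg.comp measurable_prodMk_left
      · exact (measurable_coe_ω S _ measurable_const (measurable_pi_apply _)).mul
          (hf.comp (measurable_concat.comp measurable_prodMk_left))
    · exact hg.lintegral_kernel_prod_right'
        (κ := (M.P (b + 1)).comap (fun x : Path X a b => x ⟨b, hab, le_rfl⟩)
          (measurable_pi_apply _))

end PartialSmoothing
-- Trajectories and measurability
section Algorithm

variable {X : Type*} {N : ℕ}

theorem starTraj_eq_concat {a c b : ℕ} (l : SplitTree a c) (r : SplitTree (c + 1) b)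
    (p : (Vars X N l × Vars X N r) × (Fin N × Fin N)) :
    starTraj l r p = concat (traj l p.1.1 p.2.1) (traj r p.1.2 p.2.2) := rfl

/-- Allows inner nodes and the root to share one computation. -/
theorem traj_node {a c b : ℕ} (l : SplitTree a c) (r : SplitTree (c + 1) b)
    (u : Vars X N l × Vars X N r) (i : Fin N → Fin N × Fin N) (n : Fin N) :
    traj (.node l r) (u, i) n = starTraj l r (u, i n) := by
  funext k
  simp only [traj, particle, sigma, starTraj]
  split_ifs <;> rfl

variable [MeasurableSpace X]

theorem measurable_starTraj {a c b : ℕ} {l : SplitTree a c} {r : SplitTree (c + 1) b}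
    (hl : ∀ n, Measurable fun v : Vars X N l => traj l v n)
    (hr : ∀ n, Measurable fun v : Vars X N r => traj r v n) :
    Measurable (starTraj l r : (Vars X N l × Vars X N r) × (Fin N × Fin N) → Path X a b) :=
  measurable_from_prod_countable_left fun mn => measurable_concat.comp
    (((hl mn.1).comp measurable_fst).prodMk ((hr mn.2).comp measurable_snd))

theorem measurable_traj {a b : ℕ} (t : SplitTree a b) (n : Fin N) :
    Measurable fun v : Vars X N t => traj t v n := by
  induction t generalizing n with
  | leaf a => exact measurable_pi_lambda _ fun _ => measurable_pi_apply (X := fun _ : Fin N => X) n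
  | @node a c b l r hl hr =>
    have h : Measurable fun v : (Vars X N l × Vars X N r) × (Fin N → Fin N × Fin N) =>
        starTraj l r (v.1, v.2 n) :=
      (measurable_starTraj hl hr).comp
        (measurable_fst.prodMk ((measurable_pi_apply n).comp measurable_snd))
    simp_rw [← traj_node l r] at h
    exact h

variable {T : ℕ} {M : Model X T} (S : Sampler M)

theorem measurable_weight {a b : ℕ} (t : SplitTree a b) (n : Fin N) :
    Measurable fun v : Vars X N t => weight S t v n := by
  cases t with
  | leaf =>
    exact measurable_normalizeWeights (Ω := Fin N → X)
      (fun m => (S.measurable_w a).comp (measurable_pi_apply m)) n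
  | node l r => exact measurable_const

theorem measurable_stitchWeight {a c b : ℕ} (l : SplitTree a c) (r : SplitTree (c + 1) b)
    (mn : Fin N × Fin N) :
    Measurable fun v : Vars X N l × Vars X N r => stitchWeight S l r v mn :=
  (((measurable_weight S l mn.1).comp measurable_fst).mul
    ((measurable_weight S r mn.2).comp measurable_snd)).mul
    ((S.measurable_ω (c + 1)).comp
      ((((measurable_pi_apply _).comp (measurable_traj l mn.1)).comp measurable_fst).prodMk
        (((measurable_pi_apply _).comp (measurable_traj r mn.2)).comp measurable_snd)))

theorem measurable_weightMatrix {a c b : ℕ} (l : SplitTree a c) (r : SplitTree (c + 1) b)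
    (mn : Fin N × Fin N) :
    Measurable fun v : Vars X N l × Vars X N r => weightMatrix S l r v mn :=
  measurable_normalizeWeights (measurable_stitchWeight S l r) mn

theorem measurable_normEst {a b : ℕ} (t : SplitTree a b) :
    Measurable fun v : Vars X N t => normEst S t v := by
  induction t with
  | leaf a =>
    exact measurable_const.mul (Finset.measurable_sum _ fun n _ =>
      (S.measurable_w a).comp (measurable_pi_apply (X := fun _ : Fin N => X) n))
  | @node a c b l r hl hr =>
    have h : Measurable fun v : (Vars X N l × Vars X N r) × (Fin N → Fin N × Fin N) =>
        rootNormEst S l r v.1 :=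
      (((hl.comp measurable_fst).mul (hr.comp measurable_snd)).mul
        (Finset.measurable_sum _ fun mn _ => measurable_stitchWeight S l r mn)).comp measurable_fst
    exact h

theorem measurable_rootNormEst {a c b : ℕ} (l : SplitTree a c) (r : SplitTree (c + 1) b) :
    Measurable fun v : Vars X N l × Vars X N r => rootNormEst S l r v :=
  (((measurable_normEst S l).comp measurable_fst).mul
    ((measurable_normEst S r).comp measurable_snd)).mul
    (Finset.measurable_sum _ fun mn _ => measurable_stitchWeight S l r mn)

instance sFinite_psi {a b : ℕ} (t : SplitTree a b) : SFinite (psi S t : Measure (Vars X N t)) := by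
  induction t with
  | leaf k =>
    have := S.prob_q k
    exact inferInstanceAs (SFinite (Measure.pi fun _ : Fin N => S.q k))
  | @node a c b l r hl hr =>
    exact inferInstanceAs (SFinite ((((psi S l).prod (psi S r)).prod
      (Measure.count : Measure (Fin N → Fin N × Fin N))).withDensity
        fun v => ∏ n, (weightMatrix S l r v.1 (v.2 n) : ℝ≥0∞)))

/-- Integration against a measure on `Ω × ι`, `ι` finite, with conditional mass function `p`. -/
theorem lintegral_prod_count_withDensity {Ω ι : Type*} [MeasurableSpace Ω] [MeasurableSpace ι]
    [Fintype ι] [MeasurableSingletonClass ι] (μ : Measure Ω) [SFinite μ]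
    {p F : Ω × ι → ℝ≥0∞} (hp : Measurable p) (hF : Measurable F) :
    ∫⁻ v, F v ∂(μ.prod Measure.count).withDensity p =
      ∫⁻ u, ∑ i, p (u, i) * F (u, i) ∂μ := by
  rw [lintegral_withDensity_eq_lintegral_mul _ hp hF, lintegral_prod _ (hp.mul hF).aemeasurable]
  simp_rw [lintegral_count, tsum_fintype, Pi.mul_apply]

theorem lintegral_psi_node {a c b : ℕ} (l : SplitTree a c) (r : SplitTree (c + 1) b)
    {F : (Vars X N l × Vars X N r) × (Fin N → Fin N × Fin N) → ℝ≥0∞} (hF : Measurable F) :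
    ∫⁻ v, F v ∂psi S (.node l r) =
      ∫⁻ u, ∑ i : Fin N → Fin N × Fin N, (∏ n, (weightMatrix S l r u (i n) : ℝ≥0∞)) * F (u, i)
        ∂(psi S l).prod (psi S r) :=
  lintegral_prod_count_withDensity _
    (Finset.measurable_prod _ fun n _ => (measurable_from_prod_countable_left fun i =>
      (measurable_weightMatrix S l r (i n)).coe_nnreal_ennreal)) hF

/-! ### Unbiasedness -/

theorem sum_weightMatrix (hN : 0 < N) {a c b : ℕ} (l : SplitTree a c) (r : SplitTree (c + 1) b)
    (u : Vars X N l × Vars X N r) : ∑ mn, (weightMatrix S l r u mn : ℝ≥0∞) = 1 := by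
  have : Nonempty (Fin N) := ⟨⟨0, hN⟩⟩
  exact_mod_cast sum_normalizeWeights (stitchWeight S l r u)

theorem rootNormEst_mul_weightMatrix {a c b : ℕ} (l : SplitTree a c) (r : SplitTree (c + 1) b)
    (u : Vars X N l × Vars X N r) (mn : Fin N × Fin N) :
    rootNormEst S l r u * weightMatrix S l r u mn =
      normEst S l u.1 * normEst S r u.2 * stitchWeight S l r u mn := by
  rw [rootNormEst, weightMatrix, mul_assoc, sum_mul_normalizeWeights]

/-- The particle approximation of the unnormalized smoothing measure is unbiased. -/
def IsUnbiased (N : ℕ) {a b : ℕ} (t : SplitTree a b) : Prop :=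
  ∀ f : Path X a b → ℝ≥0∞, Measurable f →
    ∫⁻ v : Vars X N t, normEst S t v * ∑ n, weight S t v n * f (traj t v n) ∂psi S t =
      ∫⁻ x, f x ∂unnormSmoothing M a b

/-- Serves both the induction step of `isUnbiased` and the final result at the root. -/
theorem lintegral_rootNormEst_mul_sum {a c b : ℕ} {l : SplitTree a c} {r : SplitTree (c + 1) b}
    (hb : b ≤ T) (hl : IsUnbiased S N l) (hr : IsUnbiased S N r) {f : Path X a b → ℝ≥0∞}
    (hf : Measurable f) :
    ∫⁻ u : Vars X N l × Vars X N r,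
        rootNormEst S l r u * ∑ mn, weightMatrix S l r u mn * f (starTraj l r (u, mn))
        ∂(psi S l).prod (psi S r) =
      ∫⁻ x, f x ∂unnormSmoothing M a b := by
  let g : Path X a c × Path X (c + 1) b → ℝ≥0∞ := fun p =>
    S.ω (c + 1) (p.1 ⟨c, l.le, le_rfl⟩) (p.2 ⟨c + 1, le_rfl, r.le⟩) * f (concat p.1 p.2)
  have hg : Measurable g :=
    (measurable_coe_ω S _ ((measurable_pi_apply _).comp measurable_fst)
      ((measurable_pi_apply _).comp measurable_snd)).mul (hf.comp measurable_concat)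
  have hstar := measurable_starTraj (X := X) (N := N) (measurable_traj l) (measurable_traj r)
  have hmeas : Measurable fun u : Vars X N l × Vars X N r =>
      (rootNormEst S l r u : ℝ≥0∞) *
        ∑ mn, weightMatrix S l r u mn * f (starTraj l r (u, mn)) :=
    (measurable_rootNormEst S l r).coe_nnreal_ennreal.mul (Finset.measurable_sum _ fun mn _ =>
      (measurable_weightMatrix S l r mn).coe_nnreal_ennreal.mul
        (hf.comp (hstar.comp measurable_prodMk_right)))
  -- Once the random normalizer has cancelled, the integrand is a left particle sum of right
  -- particle sums of `g`.
  have hint : ∀ u : Vars X N l × Vars X N r,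
      (rootNormEst S l r u : ℝ≥0∞) * ∑ mn, weightMatrix S l r u mn * f (starTraj l r (u, mn)) =
        normEst S l u.1 * ∑ m, weight S l u.1 m *
          (normEst S r u.2 * ∑ n, weight S r u.2 n * g (traj l u.1 m, traj r u.2 n)) := by
    intro u
    rw [Finset.mul_sum, Fintype.sum_prod_type, Finset.mul_sum]
    refine Finset.sum_congr rfl fun m _ => ?_
    simp only [Finset.mul_sum]
    refine Finset.sum_congr rfl fun n _ => ?_
    rw [← mul_assoc, ← ENNReal.coe_mul, rootNormEst_mul_weightMatrix, starTraj_eq_concat]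
    simp only [stitchWeight, ENNReal.coe_mul, g]
    ring
  have hinner : ∀ v : Vars X N l,
      ∫⁻ v' : Vars X N r, normEst S l v * ∑ m, weight S l v m *
          (normEst S r v' * ∑ n, weight S r v' n * g (traj l v m, traj r v' n)) ∂psi S r =
        normEst S l v * ∑ m, weight S l v m *
          ∫⁻ y, g (traj l v m, y) ∂unnormSmoothing M (c + 1) b := by
    intro v
    have hm : ∀ m, Measurable fun v' : Vars X N r =>
        (normEst S r v' : ℝ≥0∞) * ∑ n, weight S r v' n * g (traj l v m, traj r v' n) := fun m =>
      (measurable_normEst S r).coe_nnreal_ennreal.mul (Finset.measurable_sum _ fun n _ =>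
        (measurable_weight S r n).coe_nnreal_ennreal.mul
          (hg.comp (measurable_const.prodMk (measurable_traj r n))))
    rw [lintegral_const_mul _ (Finset.measurable_sum _ fun m _ => (hm m).const_mul _),
      lintegral_finsetSum _ fun m _ => (hm m).const_mul _]
    congr 1
    refine Finset.sum_congr rfl fun m _ => ?_
    rw [lintegral_const_mul _ (hm m), hr (fun y => g (traj l v m, y))
      (hg.comp measurable_prodMk_left)]
  rw [lintegral_prod _ hmeas.aemeasurable]
  simp_rw [hint, hinner]
  -- The right subtree was integrated out with the left one frozen; the resulting function of the
  -- left trajectory is a test function for `hl`.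
  rw [hl (fun x => ∫⁻ y, g (x, y) ∂unnormSmoothing M (c + 1) b) hg.lintegral_prod_right',
    ← lintegral_stitch S l.le r.le hb hf]

theorem isUnbiased_leaf (hN : 0 < N) {k : ℕ} (hk : k ≤ T) : IsUnbiased S N (.leaf k) := by
  intro f hf
  have := S.prob_q k
  have hw := (S.measurable_w k).coe_nnreal_ennreal
  have hfc : Measurable fun x : X => f fun _ => x := hf.comp (by fun_prop)
  have hint : ∀ v : Fin N → X,
      (normEst S (.leaf k) v : ℝ≥0∞) *
          ∑ n, weight S (.leaf k) v n * f (traj (.leaf k) v n) =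
        ∑ n, (N : ℝ≥0∞)⁻¹ * (S.w k (v n) * f fun _ => v n) := by
    intro v
    rw [Finset.mul_sum]
    refine Finset.sum_congr rfl fun n _ => ?_
    have h : normEst S (.leaf k) v * weight S (.leaf k) v n = (N : ℝ≥0)⁻¹ * S.w k (v n) := by
      simp only [normEst, weight]
      rw [mul_assoc, sum_mul_normalizeWeights (fun m => S.w k (v m)) n]
    rw [← mul_assoc, ← ENNReal.coe_mul, h, ENNReal.coe_mul,
      ENNReal.coe_inv (by exact_mod_cast hN.ne'), mul_assoc]
    rfl
  have hpi : ∀ n : Fin N, ∫⁻ v : Fin N → X, S.w k (v n) * f (fun _ => v n)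
      ∂Measure.pi (fun _ : Fin N => S.q k) = ∫⁻ x, f (fun _ => x) ∂M.ν k := fun n => by
    rw [← lintegral_w_mul S hk hfc]
    exact (measurePreserving_eval (fun _ : Fin N => S.q k) n).lintegral_comp (hw.mul hfc)
  have hmeas : ∀ n : Fin N, Measurable fun v : Fin N → X =>
      (S.w k (v n) : ℝ≥0∞) * f fun _ => v n := fun n =>
    (hw.mul hfc).comp (measurable_pi_apply n)
  rw [lintegral_unnormSmoothing_self M k hf]
  refine (lintegral_congr hint).trans ?_
  change ∫⁻ v : Fin N → X, _ ∂Measure.pi (fun _ : Fin N => S.q k) = _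
  rw [lintegral_finsetSum _ fun n _ => (hmeas n).const_mul _]
  simp_rw [lintegral_const_mul _ (hmeas _), hpi]
  rw [Finset.sum_const, Finset.card_univ, Fintype.card_fin, nsmul_eq_mul, ← mul_assoc,
    ENNReal.mul_inv_cancel (by simpa using hN.ne') (by simp), one_mul]

theorem isUnbiased (hN : 0 < N) {a b : ℕ} (t : SplitTree a b) (hb : b ≤ T) :
    IsUnbiased S N t := by
  induction t with
  | leaf k => exact isUnbiased_leaf S hN hb
  | @node a c b l r hl hr =>
    intro f hf
    have hcb := r.le
    rw [← lintegral_rootNormEst_mul_sum S hb (hl (by omega)) (hr hb) hf]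
    have hint : ∀ v : (Vars X N l × Vars X N r) × (Fin N → Fin N × Fin N),
        (normEst S (.node l r) v : ℝ≥0∞) *
            ∑ n, weight S (.node l r) v n * f (traj (.node l r) v n) =
          rootNormEst S l r v.1 *
            ∑ n, (N : ℝ≥0∞)⁻¹ * f (starTraj l r (v.1, v.2 n)) := by
      intro v
      congr 1
      refine Finset.sum_congr rfl fun n _ => ?_
      rw [← traj_node l r v.1 v.2 n]
      congr 1
      change (((N : ℝ≥0)⁻¹ : ℝ≥0) : ℝ≥0∞) = _
      rw [ENNReal.coe_inv (by exact_mod_cast hN.ne'), ENNReal.coe_natCast]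
    refine (lintegral_congr hint).trans ?_
    refine (lintegral_psi_node S l r ?_).trans (lintegral_congr fun u => ?_)
    · refine ((measurable_rootNormEst S l r).coe_nnreal_ennreal.comp measurable_fst).mul
        (Finset.measurable_sum _ fun n _ => measurable_const.mul (hf.comp ?_))
      exact (measurable_starTraj (measurable_traj l) (measurable_traj r)).comp
        (measurable_fst.prodMk ((measurable_pi_apply n).comp measurable_snd))
    -- The estimate does not involve the indices drawn at this node, so it leaves the sum over
    -- draws.
    · simp_rw [mul_left_comm _ (rootNormEst S l r u : ℝ≥0∞)]
      rw [← Finset.mul_sum, sum_prod_mul_average hN (fun mn => (weightMatrix S l r u mn : ℝ≥0∞))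
        (fun mn => f (starTraj l r (u, mn))) (sum_weightMatrix S hN l r u)]

/-! ### The extended target and the star trajectory -/

theorem lintegral_extendedTarget {a c b : ℕ} (l : SplitTree a c) (r : SplitTree (c + 1) b)
    {F : Vars X N l × Vars X N r → ℝ≥0∞} (hF : Measurable F) :
    ∫⁻ u, F u ∂extendedTarget S N l r =
      (normConst M a b)⁻¹ * ∫⁻ u, rootNormEst S l r u * F u ∂(psi S l).prod (psi S r) := by
  have hroot := (measurable_rootNormEst (N := N) S l r).coe_nnreal_ennreal
  rw [extendedTarget, lintegral_withDensity_eq_lintegral_mul _ (hroot.div_const _) hF,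
    ← lintegral_const_mul (f := fun u => rootNormEst S l r u * F u) _ (hroot.mul hF)]
  refine lintegral_congr fun u => ?_
  rw [Pi.mul_apply, div_eq_mul_inv, mul_comm (rootNormEst S l r u : ℝ≥0∞), mul_assoc]

theorem lintegral_smoothing {a b : ℕ} (f : Path X a b → ℝ≥0∞) :
    ∫⁻ x, f x ∂smoothing M a b = (normConst M a b)⁻¹ * ∫⁻ x, f x ∂unnormSmoothing M a b := by
  rw [smoothing, lintegral_smul_measure, smul_eq_mul]

/-- Both laws carry the same factor `(normConst M a b)⁻¹`, so it suffices to compare the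
unnormalized integrals. -/
theorem map_starLaw (hN : 0 < N) {a c b : ℕ} (hb : b ≤ T) (l : SplitTree a c)
    (r : SplitTree (c + 1) b) : (starLaw S N l r).map (starTraj l r) = smoothing M a b := by
  have hcb := r.le
  have hstar := measurable_starTraj (X := X) (N := N) (measurable_traj l) (measurable_traj r)
  have : SFinite (extendedTarget S N l r) := by unfold extendedTarget; infer_instance
  refine Measure.ext_of_lintegral _ fun f hf => ?_
  rw [lintegral_map hf hstar, starLaw, lintegral_prod_count_withDensity
    (F := fun p => f (starTraj l r p)) _ (measurable_from_prod_countable_left fun mn =>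
      (measurable_weightMatrix S l r mn).coe_nnreal_ennreal) (hf.comp hstar),
    lintegral_extendedTarget, lintegral_rootNormEst_mul_sum S hb (isUnbiased S hN l (by omega))
      (isUnbiased S hN r hb) hf, lintegral_smoothing]
  exact Finset.measurable_sum _ fun mn _ =>
    (measurable_weightMatrix S l r mn).coe_nnreal_ennreal.mul
      (hf.comp (hstar.comp measurable_prodMk_right))

theorem isProbabilityMeasure_smoothing {a b : ℕ} (hL_pos : 0 < normConst M a b)
    (hL_fin : normConst M a b < ∞) : IsProbabilityMeasure (smoothing M a b) :=
  ⟨by rw [smoothing, Measure.smul_apply, smul_eq_mul]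
      exact ENNReal.inv_mul_cancel hL_pos.ne' hL_fin.ne⟩

theorem isProbabilityMeasure_extendedTarget (hN : 0 < N) {a c b : ℕ} (hb : b ≤ T)
    (hL_pos : 0 < normConst M a b) (hL_fin : normConst M a b < ∞) (l : SplitTree a c)
    (r : SplitTree (c + 1) b) : IsProbabilityMeasure (extendedTarget S N l r) := by
  have hcb := r.le
  -- With test function 1 the weight matrix sums out, so the mean of the estimate is the normalizing
  -- constant.
  have h := lintegral_rootNormEst_mul_sum S hb (isUnbiased S hN l (by omega))
    (isUnbiased S hN r hb) (f := fun _ => 1) measurable_const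
  simp_rw [mul_one, sum_weightMatrix S hN l r] at h
  refine ⟨?_⟩
  rw [← lintegral_one, lintegral_extendedTarget S l r measurable_const, h, lintegral_one]
  exact ENNReal.inv_mul_cancel hL_pos.ne' hL_fin.ne

end Algorithm

end DSMC

end

theorem mainTheorem3 {X : Type*} [MeasurableSpace X] {T : ℕ} (M : Model X T) (S : Sampler M)
    (N : ℕ) (hN : 0 < N) {a c b : ℕ} (hb : b ≤ T)
    (hL_pos : 0 < normConst M a b) (hL_fin : normConst M a b < ∞)
    (l : SplitTree a c) (r : SplitTree (c + 1) b) :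
    IsProbabilityMeasure (extendedTarget S N l r) ∧
      IsProbabilityMeasure (smoothing M a b) ∧
      (starLaw S N l r).map (starTraj l r) = smoothing M a b := by
  exact ⟨isProbabilityMeasure_extendedTarget S hN hb hL_pos hL_fin l r,
    isProbabilityMeasure_smoothing hL_pos hL_fin, map_starLaw S hN hb l r⟩
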